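/- Let $\mathbb{K}$ be a commutative ring and let $A$ and $B$ be associative unital $\mathbb{K}$-algebras that are flat as $\mathbb{K}$-modules. Write $A\otimes B^{\mathrm{op}}=A\otimes_{\mathbb K}B^{\mathrm{op}}$, and let $\operatorname{Mod}$ denote categories of left modules. For a ring $R$, a *localizing subcategory* $\mathsf{L}\subset\operatorname{Mod}R$ is a full subcategory closed under subobjects, quotients, extensions and arbitrary direct sums. It is *stable* if, whenever $L\subset L'$ is an essential submodule and $L\in\mathsf{L}$, then $L'\in\mathsf{L}$. It is *locally finitely resolved* if the filter of left ideals $\{\mathfrak a\subset R : R/\mathfrak a\in\mathsf{L}\}$ has a cofinal inverse system consisting of left ideals $\mathfrak a$ that possess a resolution $\cdots\to R^{r_1}\to R^{r_0}\to\mathfrak a\to 0$ with all $r_i<\infty$. Let $\mathsf{M}\subset\operatorname{Mod}A$ and $\mathsf{N}\subset\operatorname{Mod}B^{\mathrm{op}}$ be stable, locally finitely resolved localizing subcategories. For an $A\otimes B^{\mathrm{op}}$-module $X$ put $\Gamma_{\mathsf M}X=\{x\in X: A\cdot x\in\mathsf M\}$ and $\Gamma_{\mathsf N}X=\{x\in X: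 B^{\mathrm{op}}\cdot x\in\mathsf N\}$; these are $A\otimes B^{\mathrm{op}}$-submodules of $X$. Let $\mathrm R\Gamma_{\mathsf M},\mathrm R\Gamma_{\mathsf N}:\mathsf D^+(\operatorname{Mod}A\otimes B^{\mathrm{op}})\to\mathsf D^+(\operatorname{Mod}A\otimes B^{\mathrm{op}})$ be the right derived functors, and put $\mathrm H^q_{\mathsf M}=\mathrm H^q\mathrm R\Gamma_{\mathsf M}$, $\mathrm H^q_{\mathsf N}=\mathrm H^q\mathrm R\Gamma_{\mathsf N}$. Suppose $M\in\mathsf D^+(\operatorname{Mod}A\otimes B^{\mathrm{op}})$ satisfies $\mathrm H^q_{\mathsf M}M\in\mathsf N$ (as a $B^{\mathrm{op}}$-module) and $\mathrm H^q_{\mathsf N}M\in\mathsf M$ (as an $A$-module) for all integers $q$. Then there is an isomorphism $$\mathrm R\Gamma_{\mathsf M}M\;\cong\;\mathrm R\Gamma_{\mathsf N}M\quad\text{in }\mathsf D(\operatorname{Mod}A\otimes B^{\mathrm{op}}),$$ functorial in $M$; that is, the restrictions of $\mathrm R\Gamma_{\mathsf M}$ and $\mathrm R\Gamma_{\mathsf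 N}$ to the full subcategory of all such $M$ are naturally isomorphic. -/

import Mathlib

open CategoryTheory Limits
open scoped TensorProduct

universe w v u

noncomputable section

namespace BimoduleSupport

section Localizing

variable {A : Type u} [Ring A]

/-- A localizing subcategory (hereditary torsion class) of the category of left `A`-modules:
a class of modules closed under subobjects, quotients, extensions and arbitrary direct sums. -/
class IsLocalizing (P : ObjectProperty (ModuleCat.{u} A)) : Prop extends P.IsSerreClass where
  closedUnderDirectSums : ∀ J : Type u, P.IsClosedUnderColimitsOfShape (Discrete J)

/-- A submodule `S ⊆ N` is essential if it meets every nonzero submodule nontrivially. -/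
def IsEssentialSubmodule {N : Type u} [AddCommGroup N] [Module A N] (S : Submodule A N) : Prop :=
  ∀ T : Submodule A N, T ≠ ⊥ → S ⊓ T ≠ ⊥

/-- A class of modules is stable if it is closed under essential extensions. -/
def IsStable (P : ObjectProperty (ModuleCat.{u} A)) : Prop :=
  ∀ (N : ModuleCat.{u} A) (S : Submodule A N),
    IsEssentialSubmodule S → P (ModuleCat.of A S) → P N

/-- The filter of left ideals `𝔞` of `A` such that `A / 𝔞` lies in `P`. -/
def idealFilter (P : ObjectProperty (ModuleCat.{u} A)) : Set (Submodule A A) :=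
  {a | P (ModuleCat.of A (A ⧸ a))}

variable (A) in
/-- A module `M` is finitely resolved if it has a resolution
`⋯ → A ^ r₂ → A ^ r₁ → A ^ r₀ → M → 0` by free modules of finite rank. -/
def IsFinitelyResolved (M : Type u) [AddCommGroup M] [Module A M] : Prop :=
  ∃ (r : ℕ → ℕ) (d : ∀ n, (Fin (r (n + 1)) → A) →ₗ[A] (Fin (r n) → A))
    (ε : (Fin (r 0) → A) →ₗ[A] M),
    Function.Surjective ε ∧ Function.Exact (d 0) ε ∧ ∀ n, Function.Exact (d (n + 1)) (d n)

/-- `P` is locally finitely resolved if the filter of left ideals of `P` has a cofinal inverse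
system (a subset directed by reverse inclusion, such that every member of the filter contains
one of its elements) consisting of left ideals that are finitely resolved as modules. -/
def IsLocallyFinitelyResolved (P : ObjectProperty (ModuleCat.{u} A)) : Prop :=
  ∃ F ⊆ idealFilter P, DirectedOn (· ≥ ·) F ∧ (∀ a ∈ idealFilter P, ∃ b ∈ F, b ≤ a) ∧
    ∀ b ∈ F, IsFinitelyResolved A b

section Torsion

variable (P : ObjectProperty (ModuleCat.{u} A)) {M N : Type u}
  [AddCommGroup M] [Module A M] [AddCommGroup N] [Module A N]

/-- The condition `A ∙ m ∈ P` on an element `m` of an `A`-module. -/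
def IsSupported (m : M) : Prop := P (ModuleCat.of A (Submodule.span A {m}))

variable [IsLocalizing P]

variable {P} in
lemma IsSupported.of_prop (h : P (ModuleCat.of A M)) (m : M) : IsSupported P m :=
  have := (ModuleCat.mono_iff_injective (ModuleCat.ofHom (Submodule.span A {m}).subtype)).2
    (Submodule.subtype_injective _)
  P.prop_of_mono (ModuleCat.ofHom (Submodule.span A {m}).subtype) h

variable {P} in
lemma prop_of_le {S T : Submodule A M} (h : S ≤ T) (hT : P (ModuleCat.of A T)) :
    P (ModuleCat.of A S) :=
  have := (ModuleCat.mono_iff_injective (ModuleCat.ofHom (Submodule.inclusion h))).2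
    (Submodule.inclusion_injective h)
  P.prop_of_mono (ModuleCat.ofHom (Submodule.inclusion h)) hT

variable {P} in
lemma prop_map (f : M →ₗ[A] N) {S : Submodule A M} (hS : P (ModuleCat.of A S)) :
    P (ModuleCat.of A (S.map f)) :=
  have := (ModuleCat.epi_iff_surjective (ModuleCat.ofHom (f.submoduleMap S))).2
    (f.submoduleMap_surjective S)
  P.prop_of_epi (ModuleCat.ofHom (f.submoduleMap S)) hS

variable {P} in
lemma IsSupported.map {m : M} (h : IsSupported P m) (f : M →ₗ[A] N) : IsSupported P (f m) := by
  have := prop_map f h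
  rwa [Submodule.map_span, Set.image_singleton] at this

variable {P} in
lemma IsSupported.smul {m : M} (h : IsSupported P m) (a : A) : IsSupported P (a • m) :=
  prop_of_le (Submodule.span_le.2 (by
    simpa using Submodule.smul_mem _ a (Submodule.mem_span_singleton_self m))) h

lemma IsSupported.zero : IsSupported P (0 : M) := by
  refine P.prop_of_isZero ?_
  have : Subsingleton (Submodule.span A {(0 : M)}) := by
    rw [Submodule.span_zero_singleton]; infer_instance
  exact ModuleCat.isZero_of_subsingleton _

variable {P} in
lemma IsSupported.add {m n : M} (hm : IsSupported P m) (hn : IsSupported P n) :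
    IsSupported P (m + n) := by
  let S := Submodule.span A {m}
  let T := Submodule.span A {n}
  have hST : P (ModuleCat.of A (S × T)) := by
    let E : ShortComplex (ModuleCat.{u} A) := ShortComplex.mk
      (ModuleCat.ofHom (LinearMap.inl A S T)) (ModuleCat.ofHom (LinearMap.snd A S T)) (by
        ext x; rfl)
    have hE : E.ShortExact :=
      { exact := (ShortComplex.ShortExact.moduleCat_exact_iff_function_exact E).2 (by
          exact .inl_snd)
        mono_f := (ModuleCat.mono_iff_injective _).2 LinearMap.inl_injective
        epi_g := (ModuleCat.epi_iff_surjective _).2 LinearMap.snd_surjective }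
    exact P.prop_X₂_of_shortExact hE hm hn
  have h := IsSupported.of_prop hST
    (⟨m, Submodule.mem_span_singleton_self m⟩, ⟨n, Submodule.mem_span_singleton_self n⟩)
  simpa using h.map (S.subtype.coprod T.subtype)

end Torsion

end Localizing

section Bimodules

variable {K : Type v} [CommRing K] {A B : Type u} [Ring A] [Ring B] [Algebra K A] [Algebra K B]

/-- The category of `K`-central `A`-`B`-bimodules, i.e. of left `A ⊗[K] Bᵐᵒᵖ`-modules. -/
abbrev Bimod (K : Type v) [CommRing K] (A B : Type u) [Ring A] [Ring B]
    [Algebra K A] [Algebra K B] := ModuleCat.{u} (A ⊗[K] Bᵐᵒᵖ)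

variable (K A B) in
/-- The forgetful functor from bimodules to left `A`-modules. -/
abbrev forgetToLeft : Bimod K A B ⥤ ModuleCat.{u} A :=
  ModuleCat.restrictScalars
    (Algebra.TensorProduct.includeLeft : A →ₐ[K] A ⊗[K] Bᵐᵒᵖ).toRingHom

variable (K A B) in
/-- The forgetful functor from bimodules to left `Bᵐᵒᵖ`-modules, i.e. right `B`-modules. -/
abbrev forgetToRight : Bimod K A B ⥤ ModuleCat.{u} Bᵐᵒᵖ :=
  ModuleCat.restrictScalars
    (Algebra.TensorProduct.includeRight : Bᵐᵒᵖ →ₐ[K] A ⊗[K] Bᵐᵒᵖ).toRingHom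

/-- The sub-bimodule `Γ_P X = {x ∈ X | A ∙ x ∈ P}` of a bimodule `X`, for a localizing
subcategory `P` of the category of left `A`-modules. -/
def leftTorsion (P : ObjectProperty (ModuleCat.{u} A)) [IsLocalizing P] (X : Bimod K A B) :
    Submodule (A ⊗[K] Bᵐᵒᵖ) X where
  carrier := {x | IsSupported (M := (forgetToLeft K A B).obj X) P x}
  add_mem' := IsSupported.add (M := (forgetToLeft K A B).obj X)
  zero_mem' := IsSupported.zero (M := (forgetToLeft K A B).obj X) P
  smul_mem' r x hx := by
    let M := (forgetToLeft K A B).obj X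
    change IsSupported (M := M) P ((r • x : X) : M)
    induction r using TensorProduct.induction_on with
    | zero =>
      have e : (0 : A ⊗[K] Bᵐᵒᵖ) • x = 0 := zero_smul (A ⊗[K] Bᵐᵒᵖ) x
      rw [e]
      exact IsSupported.zero (M := M) P
    | add r s hr hs =>
      have e : (r + s) • x = r • x + s • x := add_smul r s x
      rw [e]
      exact IsSupported.add (M := M) hr hs
    | tmul a b =>
      have comm : ∀ (c : A) (y : X), ((1 : A) ⊗ₜ[K] b) • ((c ⊗ₜ[K] (1 : Bᵐᵒᵖ)) • y) = (c ⊗ₜ[K] (1 : Bᵐᵒᵖ)) • (((1 : A) ⊗ₜ[K] b) • y) := by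
        intro c y
        rw [smul_smul, smul_smul]
        simp
      let f : M →ₗ[A] M :=
        { toFun := fun y ↦ (((1 : A) ⊗ₜ[K] b) • (y : X) : X)
          map_add' := fun y z ↦ smul_add ((1 : A) ⊗ₜ[K] b) (y : X) (z : X)
          map_smul' := comm }
      have h := (IsSupported.map (M := M) hx f).smul a
      have e : (a ⊗ₜ[K] b) • x = (a ⊗ₜ[K] (1 : Bᵐᵒᵖ)) • (((1 : A) ⊗ₜ[K] b) • x) := by
        rw [smul_smul]
        simp
      rw [e]
      exact h

/-- The sub-bimodule `Γ_Q X = {x ∈ X | Bᵐᵒᵖ ∙ x ∈ Q}` of a bimodule `X`, for a localizing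
subcategory `Q` of the category of left `Bᵐᵒᵖ`-modules. -/
def rightTorsion (Q : ObjectProperty (ModuleCat.{u} Bᵐᵒᵖ)) [IsLocalizing Q] (X : Bimod K A B) :
    Submodule (A ⊗[K] Bᵐᵒᵖ) X where
  carrier := {x | IsSupported (M := (forgetToRight K A B).obj X) Q x}
  add_mem' := IsSupported.add (M := (forgetToRight K A B).obj X)
  zero_mem' := IsSupported.zero (M := (forgetToRight K A B).obj X) Q
  smul_mem' r x hx := by
    let M := (forgetToRight K A B).obj X
    change IsSupported (M := M) Q ((r • x : X) : M)
    induction r using TensorProduct.induction_on with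
    | zero =>
      have e : (0 : A ⊗[K] Bᵐᵒᵖ) • x = 0 := zero_smul (A ⊗[K] Bᵐᵒᵖ) x
      rw [e]
      exact IsSupported.zero (M := M) Q
    | add r s hr hs =>
      have e : (r + s) • x = r • x + s • x := add_smul r s x
      rw [e]
      exact IsSupported.add (M := M) hr hs
    | tmul a b =>
      have comm : ∀ (c : Bᵐᵒᵖ) (y : X), (a ⊗ₜ[K] (1 : Bᵐᵒᵖ)) • (((1 : A) ⊗ₜ[K] c) • y) = ((1 : A) ⊗ₜ[K] c) • ((a ⊗ₜ[K] (1 : Bᵐᵒᵖ)) • y) := by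
        intro c y
        rw [smul_smul, smul_smul]
        simp
      let f : M →ₗ[Bᵐᵒᵖ] M :=
        { toFun := fun y ↦ ((a ⊗ₜ[K] (1 : Bᵐᵒᵖ)) • (y : X) : X)
          map_add' := fun y z ↦ smul_add (a ⊗ₜ[K] (1 : Bᵐᵒᵖ)) (y : X) (z : X)
          map_smul' := comm }
      have h := (IsSupported.map (M := M) hx f).smul b
      have e : (a ⊗ₜ[K] b) • x = ((1 : A) ⊗ₜ[K] b) • ((a ⊗ₜ[K] (1 : Bᵐᵒᵖ)) • x) := by
        rw [smul_smul]
        simp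
      rw [e]
      exact h

variable (K B) in
/-- The torsion functor `Γ_P` on bimodules, a subfunctor of the identity. -/
def leftΓ (P : ObjectProperty (ModuleCat.{u} A)) [IsLocalizing P] :
    Bimod K A B ⥤ Bimod K A B where
  obj X := ModuleCat.of _ (leftTorsion P X)
  map {X Y} f := ModuleCat.ofHom (f.hom.restrict (p := leftTorsion P X) (q := leftTorsion P Y)
    fun _ hx ↦ IsSupported.map (M := (forgetToLeft K A B).obj X)
      (N := (forgetToLeft K A B).obj Y) hx ((forgetToLeft K A B).map f).hom)

variable (K A) in
/-- The torsion functor `Γ_Q` on bimodules, a subfunctor of the identity. -/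
def rightΓ (Q : ObjectProperty (ModuleCat.{u} Bᵐᵒᵖ)) [IsLocalizing Q] :
    Bimod K A B ⥤ Bimod K A B where
  obj X := ModuleCat.of _ (rightTorsion Q X)
  map {X Y} f := ModuleCat.ofHom (f.hom.restrict (p := rightTorsion Q X) (q := rightTorsion Q Y)
    fun _ hx ↦ IsSupported.map (M := (forgetToRight K A B).obj X)
      (N := (forgetToRight K A B).obj Y) hx ((forgetToRight K A B).map f).hom)

instance (P : ObjectProperty (ModuleCat.{u} A)) [IsLocalizing P] :
    (leftΓ K B P).Additive where

instance (Q : ObjectProperty (ModuleCat.{u} Bᵐᵒᵖ)) [IsLocalizing Q] :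
    (rightΓ K A Q).Additive where

variable [HasDerivedCategory.{w} (Bimod K A B)]

variable (K B) in
/-- The right derived functor `RΓ_P` on the bounded below derived category of bimodules. -/
abbrev leftRΓ (P : ObjectProperty (ModuleCat.{u} A)) [IsLocalizing P] :
    DerivedCategory.Plus (Bimod K A B) ⥤ DerivedCategory.Plus (Bimod K A B) :=
  (leftΓ K B P).rightDerivedFunctorPlus

variable (K A) in
/-- The right derived functor `RΓ_Q` on the bounded below derived category of bimodules. -/
abbrev rightRΓ (Q : ObjectProperty (ModuleCat.{u} Bᵐᵒᵖ)) [IsLocalizing Q] :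
    DerivedCategory.Plus (Bimod K A B) ⥤ DerivedCategory.Plus (Bimod K A B) :=
  (rightΓ K A Q).rightDerivedFunctorPlus

variable (K) in
/-- The complexes of bimodules `X`, bounded below, such that for all integers `q` the cohomology
`H^q_P X = H^q (RΓ_P X)` lies in `Q` as a `Bᵐᵒᵖ`-module, and the cohomology
`H^q_Q X = H^q (RΓ_Q X)` lies in `P` as an `A`-module. -/
def crossSupported (P : ObjectProperty (ModuleCat.{u} A)) [IsLocalizing P]
    (Q : ObjectProperty (ModuleCat.{u} Bᵐᵒᵖ)) [IsLocalizing Q] :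
    ObjectProperty (DerivedCategory.Plus (Bimod K A B)) := fun X ↦
  ∀ q : ℤ,
    Q ((forgetToRight K A B).obj
      ((DerivedCategory.Plus.homologyFunctor _ q).obj ((leftRΓ K B P).obj X))) ∧
    P ((forgetToLeft K A B).obj
      ((DerivedCategory.Plus.homologyFunctor _ q).obj ((rightRΓ K A Q).obj X)))

end Bimodules

end BimoduleSupport

end

/-! With its counit, `RΓ_P` is a coreflection of the bounded below derived category of bimodules
onto the complexes whose cohomology is `P`-torsion over `A`; likewise `RΓ_Q`, over `Bᵐᵒᵖ`. If `RΓ_P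
X` also has `Q`-torsion cohomology, its counit to `X` factors uniquely through `RΓ_Q X`;
symmetrically the other way. The two factorizations are mutually inverse and natural by uniqueness
(`coreflectionIso`).

The main point is that the counit is invertible on complexes with torsion cohomology. Represent such
a complex by injective bimodules `K`. By flatness the terms stay injective over `A`, and by
stability the torsion submodule of an injective is a direct summand, so `K/ΓK` consists of
torsion-free injective `A`-modules. Its cohomology is torsion, so it is acyclic
(`acyclic_of_isTorsionFree`) and `ΓK → K` is a quasi-isomorphism (`IsStableTorsion.quasiIso`). -/

namespace BimoduleSupport

/-! ### Comparison of two coreflections on a category. -/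

section Coreflection

variable {D : Type*} [Category* D] {Γ₁ Γ₂ : D ⥤ D} (c₁ : Γ₁ ⟶ 𝟭 D) (c₂ : Γ₂ ⟶ 𝟭 D)
  (D₁ D₂ : ObjectProperty D)

/-- A functor `Γ` equipped with `c : Γ ⟶ 𝟭 D` is a coreflection onto the objects satisfying
a property if its values satisfy it, if `c` is an isomorphism on objects satisfying it, and if
`Γ` and `c` commute. -/
structure IsCoreflection {Γ : D ⥤ D} (c : Γ ⟶ 𝟭 D) (P : ObjectProperty D) : Prop where
  prop_obj (X : D) : P (Γ.obj X)
  isIso (X : D) (hX : P X) : IsIso (c.app X)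
  map_app (X : D) : Γ.map (c.app X) = c.app (Γ.obj X)

variable {c₁ c₂ D₁ D₂}

/-- A morphism `k` from `W` is recovered from `k ≫ c₁.app X` by applying `Γ₁` and inverting `c₁.app
W`. -/
lemma IsCoreflection.hom_ext (h : IsCoreflection c₁ D₁) {W X : D} (hW : D₁ W)
    {f g : W ⟶ Γ₁.obj X} (hfg : f ≫ c₁.app X = g ≫ c₁.app X) : f = g := by
  have := h.isIso W hW
  have key (k : W ⟶ Γ₁.obj X) : c₁.app W ≫ k = Γ₁.map (k ≫ c₁.app X) := by
    rw [Functor.map_comp, h.map_app]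
    exact (c₁.naturality k).symm
  rw [← cancel_epi (c₁.app W), key, key, hfg]

/-- The comparison of two coreflections, on an object whose first coreflection satisfies the
second property. -/
noncomputable def coreflectionHom (h₂ : IsCoreflection c₂ D₂) (X : D) (hX : D₂ (Γ₁.obj X)) :
    Γ₁.obj X ⟶ Γ₂.obj X :=
  have := h₂.isIso _ hX
  inv (c₂.app (Γ₁.obj X)) ≫ Γ₂.map (c₁.app X)

lemma coreflectionHom_comp (h₂ : IsCoreflection c₂ D₂) (X : D) (hX : D₂ (Γ₁.obj X)) :
    coreflectionHom (c₁ := c₁) h₂ X hX ≫ c₂.app X = c₁.app X := by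
  have := h₂.isIso _ hX
  have e : Γ₂.map (c₁.app X) ≫ c₂.app X = c₂.app (Γ₁.obj X) ≫ c₁.app X := c₂.naturality _
  simp [coreflectionHom, e]

variable (D₁ D₂) in
/-- The objects such that each of the two coreflections satisfies both properties. -/
def crossProperty (Γ₁ Γ₂ : D ⥤ D) : ObjectProperty D :=
  fun X ↦ D₂ (Γ₁.obj X) ∧ D₁ (Γ₂.obj X)

/-- Two coreflections agree on the objects such that each of them satisfies both properties. -/
noncomputable def coreflectionIso (h₁ : IsCoreflection c₁ D₁) (h₂ : IsCoreflection c₂ D₂) :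
    (crossProperty D₁ D₂ Γ₁ Γ₂).ι ⋙ Γ₁ ≅ (crossProperty D₁ D₂ Γ₁ Γ₂).ι ⋙ Γ₂ :=
  NatIso.ofComponents (fun X ↦
    { hom := coreflectionHom (c₁ := c₁) h₂ X.obj X.property.1
      inv := coreflectionHom (c₁ := c₂) h₁ X.obj X.property.2
      hom_inv_id := h₁.hom_ext (h₁.prop_obj _) (by
        dsimp
        rw [Category.assoc, coreflectionHom_comp, coreflectionHom_comp, Category.id_comp])
      inv_hom_id := h₂.hom_ext (h₂.prop_obj _) (by
        dsimp
        rw [Category.assoc, coreflectionHom_comp, coreflectionHom_comp, Category.id_comp]) })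
    (fun {X Y} f ↦ h₂.hom_ext X.property.1 (by
      have e₁ : Γ₁.map f.hom ≫ c₁.app Y.obj = c₁.app X.obj ≫ f.hom := c₁.naturality _
      have e₂ : Γ₂.map f.hom ≫ c₂.app Y.obj = c₂.app X.obj ≫ f.hom := c₂.naturality _
      dsimp
      rw [Category.assoc, coreflectionHom_comp, Category.assoc, e₂, e₁, ← Category.assoc,
        coreflectionHom_comp]))

end Coreflection

/-! ### Complexes of torsion-free injectives in an abelian category. -/

section TorsionFree

variable {C : Type*} [Category* C] [Abelian C] (P : ObjectProperty C)

/-- An object is torsion-free if it receives no nonzero morphism from an object of `P`. -/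
def IsTorsionFree (X : C) : Prop := ∀ ⦃W : C⦄, P W → ∀ f : W ⟶ X, f = 0

variable {P}

lemma IsTorsionFree.of_mono {X Y : C} (hY : IsTorsionFree P Y) (i : X ⟶ Y) [Mono i] :
    IsTorsionFree P X := fun W hW f ↦ by
  rw [← cancel_mono i, hY hW (f ≫ i), zero_comp]

/-- The sequence splits because `S.X₁` is injective, so `S.X₃` is a direct summand of `S.X₂`. -/
lemma isTorsionFree_and_injective_of_shortExact {S : ShortComplex C} (hS : S.ShortExact)
    [Injective S.X₁] [Injective S.X₂] (h : IsTorsionFree P S.X₂) :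
    IsTorsionFree P S.X₃ ∧ Injective S.X₃ := by
  have s := hS.splittingOfInjective
  have : IsSplitMono s.s := ⟨⟨S.g, s.s_g⟩⟩
  exact ⟨h.of_mono s.s, (Retract.mk s.s S.g s.s_g).injective⟩

/-- The inductive step for acyclicity: the kernel of `K.opcycles m ⟶ K.X n` is the homology at `m`,
so exactness there embeds `K.opcycles m` in `K.X n`. -/
lemma shortExact_opcycles (K : CochainComplex C ℤ) {m n : ℤ} (hmn : m + 1 = n)
    (hm : K.ExactAt m) :
    (ShortComplex.mk (K.fromOpcycles m n) (K.pOpcycles n) (by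
      rw [← cancel_epi (K.pOpcycles m)]; simp)).ShortExact := by
  have hS₁ : (ShortComplex.mk (K.d m n) (K.pOpcycles n) (by simp)).Exact :=
    ShortComplex.exact_of_g_is_cokernel _ (K.opcyclesIsCokernel m n (by simp [← hmn]))
  refine { exact := ?_, mono_f := ?_, epi_g := inferInstanceAs (Epi (K.pOpcycles n)) }
  · let φ : ShortComplex.mk (K.d m n) (K.pOpcycles n) (by simp) ⟶
        ShortComplex.mk (K.fromOpcycles m n) (K.pOpcycles n) (by
          rw [← cancel_epi (K.pOpcycles m)]; simp) :=
      { τ₁ := K.pOpcycles m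
        τ₂ := 𝟙 _
        τ₃ := 𝟙 _ }
    have : Epi φ.τ₁ := inferInstanceAs (Epi (K.pOpcycles m))
    have : IsIso φ.τ₂ := inferInstanceAs (IsIso (𝟙 _))
    have : Mono φ.τ₃ := inferInstanceAs (Mono (𝟙 _))
    exact (ShortComplex.exact_iff_of_epi_of_isIso_of_mono φ).1 hS₁
  · have hk := K.homologyIsKernel m n (by simp [← hmn])
    exact (Preadditive.mono_iff_cancel_zero _).2 fun A g hg ↦ by
      obtain ⟨l, hl⟩ := KernelFork.IsLimit.lift' hk g hg
      rw [← hl, hm.isZero_homology.eq_of_tgt l 0, zero_comp]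

/-- A bounded below complex of torsion-free injectives whose homology is torsion is acyclic. -/
lemma acyclic_of_isTorsionFree [P.IsSerreClass] (K : CochainComplex C ℤ) (n₀ : ℤ)
    [K.IsStrictlyGE n₀] (hI : ∀ n, Injective (K.X n)) (hK : ∀ n, IsTorsionFree P (K.X n))
    (hP : ∀ n, P (K.homology n)) : K.Acyclic := by
  have hz (n : ℤ) (hn : n < n₀) : IsZero (K.X n) := K.isZero_of_isStrictlyGE n₀ n hn
  -- The homology at `m` is a torsion subobject of `K.opcycles m`, hence zero if the latter is
  -- torsion-free.
  have exact_of (m : ℤ) (h : IsTorsionFree P (K.opcycles m)) : K.ExactAt m := by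
    rw [K.exactAt_iff_isZero_homology, IsZero.iff_id_eq_zero, ← cancel_mono (K.homologyι m),
      h (hP m) (K.homologyι m), comp_zero, comp_zero]
  have h (m : ℤ) (hm : n₀ - 1 ≤ m) :
      IsTorsionFree P (K.opcycles m) ∧ Injective (K.opcycles m) := by
    -- The induction starts one degree below `n₀`, where the opcycles vanish.
    induction m, hm using Int.leInduction with
    | base =>
      have hO : IsZero (K.opcycles (n₀ - 1)) :=
        (hz _ (by lia)).of_epi (K.pOpcycles (n₀ - 1))
      exact ⟨fun W _ f ↦ hO.eq_of_tgt _ _, hO.injective⟩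
    | succ m _ ih =>
      have hS := shortExact_opcycles K rfl (exact_of m ih.1)
      have : Injective (K.opcycles m) := ih.2
      have := hI (m + 1)
      exact isTorsionFree_and_injective_of_shortExact hS (hK _)
  intro n
  by_cases hn : n₀ - 1 ≤ n
  · exact exact_of n (h n hn).1
  · exact .of_isZero (hz n (by lia))

end TorsionFree

/-! ### Torsion subcomplexes of complexes of injectives. -/

section Torsion

variable {C D : Type*} [Category* C] [Category* D] [Abelian C] [Abelian D]

/-- The morphism of complexes with components `i.app (K.X n)`, for a natural transformation
`i : Γ ⟶ 𝟭 C`. -/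
@[simps]
def mapComplexTo {Γ : C ⥤ C} [Γ.Additive] (i : Γ ⟶ 𝟭 C) (K : CochainComplex C ℤ) :
    (Γ.mapHomologicalComplex (.up ℤ)).obj K ⟶ K where
  f n := i.app (K.X n)
  comm' _ _ _ := (i.naturality _).symm

lemma mapComplexTo_naturality {Γ : C ⥤ C} [Γ.Additive] (i : Γ ⟶ 𝟭 C) {K L : CochainComplex C ℤ}
    (f : K ⟶ L) :
    (Γ.mapHomologicalComplex (.up ℤ)).map f ≫ mapComplexTo i L = mapComplexTo i K ≫ f := by
  ext n
  exact i.naturality _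

/-- A subfunctor `i : Γ ⟶ 𝟭 C` of the identity is a stable torsion functor for a class `P` of
objects of `D`, along an exact functor `F : C ⥤ D`, if it is idempotent, if its values lie in `P`,
and if on an injective object its cokernel becomes torsion-free and injective in `D`. -/
structure IsStableTorsion {Γ : C ⥤ C} (i : Γ ⟶ 𝟭 C) (F : C ⥤ D) (P : ObjectProperty D) :
    Prop where
  mono_app (X : C) : Mono (i.app X)
  isIso_app (X : C) : IsIso (i.app (Γ.obj X))
  prop_obj (X : C) : P (F.obj (Γ.obj X))
  isTorsionFree (X : C) [Injective X] : IsTorsionFree P (F.obj (cokernel (i.app X)))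
  injective (X : C) [Injective X] : Injective (F.obj (cokernel (i.app X)))

variable {Γ : C ⥤ C} [Γ.Additive] {i : Γ ⟶ 𝟭 C} {F : C ⥤ D} {P : ObjectProperty D}

-- Naturality of `i` at `i.app X` equates the two sides after composition with the monomorphism
-- `i.app X`.
omit [Γ.Additive] in
lemma IsStableTorsion.map_app (h : IsStableTorsion i F P) (X : C) :
    Γ.map (i.app X) = i.app (Γ.obj X) := by
  have := h.mono_app X
  rw [← cancel_mono (i.app X)]
  exact i.naturality (i.app X)

lemma prop_homology (T : ObjectProperty C) [T.IsSerreClass] (K : CochainComplex C ℤ) (n : ℤ)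
    (h : T (K.X n)) : T (K.homology n) :=
  T.prop_of_epi (K.homologyπ n) (T.prop_of_mono (K.iCycles n) h)

variable [PreservesFiniteLimits F] [PreservesFiniteColimits F] [P.IsSerreClass]

lemma IsStableTorsion.prop_homology_map (h : IsStableTorsion i F P) (K : CochainComplex C ℤ)
    (n : ℤ) : P (F.obj (((Γ.mapHomologicalComplex (.up ℤ)).obj K).homology n)) :=
  prop_homology (P.inverseImage F) ((Γ.mapHomologicalComplex (.up ℤ)).obj K) n (h.prop_obj (K.X n))

variable [F.Additive] [F.Faithful]

/-- A bounded below complex of injectives with torsion homology is quasi-isomorphic to its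
torsion subcomplex. -/
lemma IsStableTorsion.quasiIso (h : IsStableTorsion i F P) (K : CochainComplex C ℤ) (n₀ : ℤ)
    [K.IsStrictlyGE n₀] (hI : ∀ n, Injective (K.X n)) (hK : ∀ n, P (F.obj (K.homology n))) :
    QuasiIso (mapComplexTo i K) := by
  have : Mono (mapComplexTo i K) :=
    HomologicalComplex.mono_of_mono_f _ fun n ↦ h.mono_app (K.X n)
  let S := ShortComplex.mk (mapComplexTo i K) (cokernel.π (mapComplexTo i K)) (by simp)
  have hS : S.ShortExact :=
    { exact := ShortComplex.exact_cokernel _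
      mono_f := this
      epi_g := inferInstanceAs (Epi (cokernel.π _)) }
  let e (n : ℤ) : S.X₃.X n ≅ cokernel (i.app (K.X n)) :=
    PreservesCokernel.iso (HomologicalComplex.eval C (.up ℤ) n) (mapComplexTo i K)
  -- Acyclicity of the quotient complex is tested in `D`, the only place where its terms are known
  -- to be injective.
  let L : CochainComplex D ℤ := (F.mapHomologicalComplex (.up ℤ)).obj S.X₃
  have : CochainComplex.IsStrictlyGE S.X₃ n₀ := (CochainComplex.isStrictlyGE_iff _ _).2 fun n hn ↦ by
    exact ((K.isZero_of_isStrictlyGE n₀ n hn).of_epi (cokernel.π (i.app (K.X n)))).of_iso (e n)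
  have : L.IsStrictlyGE n₀ := by dsimp only [L]; infer_instance
  let eF (n : ℤ) : L.X n ≅ F.obj (cokernel (i.app (K.X n))) := F.mapIso (e n)
  let eL (n : ℤ) : L.homology n ≅ F.obj (S.X₃.homology n) := (S.X₃.sc n).mapHomologyIso F
  have hL : L.Acyclic := by
    refine acyclic_of_isTorsionFree (P := P) L n₀ (fun n ↦ ?_) (fun n ↦ ?_) (fun n ↦ ?_)
    · have := hI n
      have := h.injective (K.X n)
      exact Injective.of_iso (eF n).symm this
    · have := hI n
      exact (h.isTorsionFree (K.X n)).of_mono (eF n).hom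
    · refine P.prop_of_iso (eL n).symm ?_
      -- In the long exact sequence, the homology of the quotient sits between that of `K` in degree
      -- `n` and that of `ΓK` in degree `n + 1`.
      exact (P.inverseImage F).prop_X₂_of_exact (hS.homology_exact₃ n (n + 1) rfl) (hK n)
        (h.prop_homology_map K (n + 1))
  have hS₃ (n : ℤ) : IsZero (S.X₃.homology n) := by
    rw [IsZero.iff_id_eq_zero]
    -- A faithful additive functor reflects zero objects.
    apply F.map_injective
    rw [F.map_id, F.map_zero]
    exact ((hL n).isZero_homology.of_iso (eL n).symm).eq_of_src _ _
  refine ⟨fun n ↦ ?_⟩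
  rw [quasiIsoAt_iff_isIso_homologyMap]
  have : Mono (HomologicalComplex.homologyMap S.f n) :=
    (hS.homology_exact₁ (n - 1) n (by simp)).mono_g ((hS₃ _).eq_of_src _ _)
  have : Epi (HomologicalComplex.homologyMap S.f n) :=
    (hS.homology_exact₂ n).epi_f ((hS₃ _).eq_of_tgt _ _)
  exact isIso_of_mono_of_epi _

end Torsion

/-! ### The derived torsion functor is a coreflection. -/

section Derived

variable {C D : Type*} [Category* C] [Category* D] [Abelian C] [Abelian D]
  {Γ : C ⥤ C} [Γ.Additive] (i : Γ ⟶ 𝟭 C) {F : C ⥤ D} {P : ObjectProperty D}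

/-- The natural transformation on bounded below homotopy categories induced by `i : Γ ⟶ 𝟭 C`. -/
def mapHomotopyTo : Γ.mapHomotopyCategoryPlus ⟶ 𝟭 (HomotopyCategory.Plus C) where
  app K := ObjectProperty.homMk
    ((HomotopyCategory.quotient C (.up ℤ)).map (mapComplexTo i K.obj.as))
  naturality K L f := by
    obtain ⟨K, rfl⟩ := HomotopyCategory.Plus.quotient_obj_surjective K
    obtain ⟨L, rfl⟩ := HomotopyCategory.Plus.quotient_obj_surjective L
    obtain ⟨f, rfl⟩ := (HomotopyCategory.Plus.quotient C).map_surjective f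
    ext
    exact (HomotopyCategory.quotient C (.up ℤ)).congr_map (mapComplexTo_naturality i f.hom)

lemma IsStableTorsion.isIso_mapHomotopyTo {i : Γ ⟶ 𝟭 C} (h : IsStableTorsion i F P)
    (K : HomotopyCategory.Plus C) :
    IsIso ((mapHomotopyTo i).app (Γ.mapHomotopyCategoryPlus.obj K)) := by
  obtain ⟨K, rfl⟩ := HomotopyCategory.Plus.quotient_obj_surjective K
  have (n : ℤ) : IsIso ((mapComplexTo i (Γ.mapCochainComplexPlus.obj K).obj).f n) :=
    h.isIso_app _
  have h' := HomologicalComplex.Hom.isIso_of_components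
    (mapComplexTo i (Γ.mapCochainComplexPlus.obj K).obj)
  rw [← isIso_iff_of_reflects_iso _ (HomotopyCategory.Plus.ι C)]
  exact inferInstanceAs (IsIso ((HomotopyCategory.quotient C (.up ℤ)).map
    (mapComplexTo i (Γ.mapCochainComplexPlus.obj K).obj)))

lemma IsStableTorsion.map_mapHomotopyTo {i : Γ ⟶ 𝟭 C} (h : IsStableTorsion i F P)
    (K : HomotopyCategory.Plus C) :
    Γ.mapHomotopyCategoryPlus.map ((mapHomotopyTo i).app K) =
      (mapHomotopyTo i).app (Γ.mapHomotopyCategoryPlus.obj K) := by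
  obtain ⟨K, rfl⟩ := HomotopyCategory.Plus.quotient_obj_surjective K
  have e : (Γ.mapHomologicalComplex (.up ℤ)).map (mapComplexTo i K.obj) =
      mapComplexTo i ((Γ.mapHomologicalComplex (.up ℤ)).obj K.obj) := by
    ext n
    exact h.map_app (K.obj.X n)
  ext
  exact (HomotopyCategory.quotient C (.up ℤ)).congr_map e

variable [HasDerivedCategory C] [EnoughInjectives C]

/-- The natural transformation `RΓ ⟶ 𝟭` induced by `i : Γ ⟶ 𝟭 C`. -/
noncomputable def derivedTo : Γ.rightDerivedFunctorPlus ⟶ 𝟭 (DerivedCategory.Plus C) :=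
  Γ.rightDerivedFunctorPlus.rightDerivedDesc Γ.rightDerivedFunctorPlusUnit
    (HomotopyCategory.Plus.quasiIso C) (𝟭 _)
    (Functor.whiskerRight (mapHomotopyTo i) DerivedCategory.Plus.Qh)

lemma unit_derivedTo (K : HomotopyCategory.Plus C) :
    Γ.rightDerivedFunctorPlusUnit.app K ≫ (derivedTo i).app (DerivedCategory.Plus.Qh.obj K) =
      DerivedCategory.Plus.Qh.map ((mapHomotopyTo i).app K) :=
  Functor.rightDerived_fac_app _ _ _ _ _ _

/-- The complexes in the bounded below derived category whose homology lies in `P`. -/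
def homologyIn (F : C ⥤ D) (P : ObjectProperty D) : ObjectProperty (DerivedCategory.Plus C) :=
  fun X ↦ ∀ q : ℤ, P (F.obj ((DerivedCategory.Plus.homologyFunctor C q).obj X))

/-- Every object of the bounded below derived category is represented by a complex of
injectives. -/
lemma exists_injective_iso (X : DerivedCategory.Plus C) :
    ∃ K : CochainComplex.Plus (InjectiveObject C),
      Nonempty (DerivedCategory.Plus.Qh.obj ((HomotopyCategory.Plus.quotient C).obj
        ((InjectiveObject.ι C).mapCochainComplexPlus.obj K)) ≅ X) := by
  obtain ⟨n, hn⟩ := X.property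
  have : X.IsGE n := (DerivedCategory.Plus.isGE_ι_obj_iff X n).1 hn
  obtain ⟨K, -, e⟩ := DerivedCategory.Plus.exists_injective_nonempty_iso X n
  exact ⟨K, e⟩

/-- The homology of the image of a complex in the bounded below derived category. -/
noncomputable def homologyQhIso (K : CochainComplex.Plus C) (q : ℤ) :
    (DerivedCategory.Plus.homologyFunctor C q).obj
      (DerivedCategory.Plus.Qh.obj ((HomotopyCategory.Plus.quotient C).obj K)) ≅
    K.obj.homology q :=
  (DerivedCategory.homologyFunctor C q).mapIso
    ((DerivedCategory.quotientCompQhIso C).app K.obj) ≪≫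
    (DerivedCategory.homologyFunctorFactors C q).app K.obj

omit [EnoughInjectives C] in
lemma isIso_Qh_map {K L : HomotopyCategory.Plus C} (f : K ⟶ L)
    (hf : HomotopyCategory.Plus.quasiIso C f) : IsIso (DerivedCategory.Plus.Qh.map f) :=
  Localization.inverts DerivedCategory.Plus.Qh (HomotopyCategory.Plus.quasiIso C) f hf

variable [PreservesFiniteLimits F] [PreservesFiniteColimits F] [P.IsSerreClass]
  [F.Additive] [F.Faithful]

variable {i}

instance homologyIn_isClosedUnderIsomorphisms :
    (homologyIn F P).IsClosedUnderIsomorphisms where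
  of_iso e h q := P.prop_of_iso
    (F.mapIso ((DerivedCategory.Plus.homologyFunctor C q).mapIso e)) (h q)

omit [F.Additive] [F.Faithful] in
lemma IsStableTorsion.homologyIn_derived (h : IsStableTorsion i F P)
    (X : DerivedCategory.Plus C) : homologyIn F P (Γ.rightDerivedFunctorPlus.obj X) := by
  obtain ⟨K, ⟨e⟩⟩ := exists_injective_iso X
  refine (homologyIn F P).prop_of_iso (Γ.rightDerivedFunctorPlus.mapIso e) ?_
  refine (homologyIn F P).prop_of_iso (asIso (Γ.rightDerivedFunctorPlusUnit.app _)) ?_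
  intro q
  exact P.prop_of_iso (F.mapIso (homologyQhIso (Γ.mapCochainComplexPlus.obj
    ((InjectiveObject.ι C).mapCochainComplexPlus.obj K)) q).symm) (h.prop_homology_map _ q)

/-- On a complex `K` of injectives the unit is invertible, so `derivedTo` is, up to isomorphism, the
image of `ΓK → K`, a quasi-isomorphism. -/
lemma IsStableTorsion.isIso_derivedTo (h : IsStableTorsion i F P)
    (X : DerivedCategory.Plus C) (hX : homologyIn F P X) : IsIso ((derivedTo i).app X) := by
  obtain ⟨K, ⟨e⟩⟩ := exists_injective_iso X
  rw [← NatTrans.isIso_app_iff_of_iso (derivedTo i) e]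
  replace hX := (homologyIn F P).prop_of_iso e.symm hX
  have hq : IsIso (DerivedCategory.Plus.Qh.map ((mapHomotopyTo i).app
      ((HomotopyCategory.Plus.quotient C).obj
        ((InjectiveObject.ι C).mapCochainComplexPlus.obj K)))) := by
    apply isIso_Qh_map
    obtain ⟨n, hn⟩ := K.property
    let K' := ((InjectiveObject.ι C).mapCochainComplexPlus.obj K).obj
    have : K'.IsStrictlyGE n := by
      have : K.obj.IsStrictlyGE n := hn
      exact inferInstanceAs (CochainComplex.IsStrictlyGE
        (((InjectiveObject.ι C).mapHomologicalComplex (.up ℤ)).obj K.obj) n)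
    exact (HomotopyCategory.quotient_map_mem_quasiIso_iff _).2 (h.quasiIso K' n
      (fun m ↦ inferInstanceAs (Injective (K.obj.X m).obj))
      (fun q ↦ P.prop_of_iso (F.mapIso (homologyQhIso _ q)) (hX q)))
  rw [← unit_derivedTo] at hq
  exact (isIso_comp_left_iff _ _).1 hq

/-- After reduction to a complex of injectives, this descends from `Γ(i) = i_Γ` on complexes,
provided the unit is invertible also at `ΓK`, whose terms need not be injective in `C`. -/
lemma IsStableTorsion.map_derivedTo (h : IsStableTorsion i F P) (X : DerivedCategory.Plus C) :
    Γ.rightDerivedFunctorPlus.map ((derivedTo i).app X) =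
      (derivedTo i).app (Γ.rightDerivedFunctorPlus.obj X) := by
  obtain ⟨K, ⟨e⟩⟩ := exists_injective_iso X
  have n₁ := (derivedTo i).naturality e.hom
  have n₂ := (derivedTo i).naturality (Γ.rightDerivedFunctorPlus.map e.hom)
  simp only [Functor.id_map] at n₁ n₂
  rw [← cancel_epi (Γ.rightDerivedFunctorPlus.map (Γ.rightDerivedFunctorPlus.map e.hom)), n₂,
    ← Functor.map_comp, n₁, Functor.map_comp]
  congr 1
  set K₀ := (HomotopyCategory.Plus.quotient C).obj
    ((InjectiveObject.ι C).mapCochainComplexPlus.obj K) with hK₀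
  let Z := Γ.mapHomotopyCategoryPlus.obj K₀
  let u := Γ.rightDerivedFunctorPlusUnit
  have hu : IsIso (u.app K₀) := by dsimp only [u, hK₀]; infer_instance
  have hZ : IsIso ((mapHomotopyTo i).app Z) := h.isIso_mapHomotopyTo K₀
  -- Two out of three in `unit_derivedTo`: `derivedTo` is invertible at `Z` because its homology is
  -- torsion, and `mapHomotopyTo` is by idempotence of `Γ`.
  have huZ : IsIso (u.app Z) := by
    have h₁ : IsIso ((derivedTo i).app (DerivedCategory.Plus.Qh.obj Z)) :=
      h.isIso_derivedTo _ ((homologyIn F P).prop_of_iso (asIso (u.app K₀)).symm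
        (h.homologyIn_derived _))
    have h₂ : IsIso (u.app Z ≫ (derivedTo i).app (DerivedCategory.Plus.Qh.obj Z)) := by
      rw [unit_derivedTo]; infer_instance
    exact (isIso_comp_right_iff _ _).1 h₂
  have n₃ := (derivedTo i).naturality (u.app K₀)
  have n₄ := u.naturality ((mapHomotopyTo i).app K₀)
  simp only [Functor.id_map, Functor.comp_map] at n₃ n₄
  rw [← cancel_epi (Γ.rightDerivedFunctorPlus.map (u.app K₀)), ← Functor.map_comp,
    unit_derivedTo, ← cancel_epi (u.app Z)]
  refine n₄.symm.trans ?_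
  rw [h.map_mapHomotopyTo, ← unit_derivedTo, Category.assoc]
  exact congr(u.app Z ≫ $(n₃.symm))

/-- The right derived functor of a stable torsion functor is a coreflection onto the complexes
with torsion homology. -/
lemma IsStableTorsion.isCoreflection (h : IsStableTorsion i F P) :
    IsCoreflection (derivedTo i) (homologyIn F P) where
  prop_obj := h.homologyIn_derived
  isIso := h.isIso_derivedTo
  map_app := h.map_derivedTo

end Derived

/-! ### Stable torsion in module categories. -/

section Modules

variable {S : Type u} [Ring S] {P : ObjectProperty (ModuleCat.{u} S)} [IsLocalizing P]

lemma prop_of_injective {M N : Type u} [AddCommGroup M] [Module S M] [AddCommGroup N] [Module S N]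
    (f : M →ₗ[S] N) (hf : Function.Injective f) (h : P (ModuleCat.of S N)) :
    P (ModuleCat.of S M) :=
  have := (ModuleCat.mono_iff_injective (ModuleCat.ofHom f)).2 hf
  P.prop_of_mono (ModuleCat.ofHom f) h

lemma IsSupported.of_injective {M N : Type u} [AddCommGroup M] [Module S M] [AddCommGroup N]
    [Module S N] {f : M →ₗ[S] N} (hf : Function.Injective f) {m : M}
    (h : IsSupported P (f m)) : IsSupported P m := by
  have hle : ∀ x ∈ Submodule.span S {m}, f x ∈ Submodule.span S {f m} := fun x hx ↦ by
    have := Submodule.mem_map_of_mem (f := f) hx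
    rwa [Submodule.map_span, Set.image_singleton] at this
  exact prop_of_injective (f.restrict hle) (fun x y hxy ↦
    Subtype.ext (hf (congr_arg Subtype.val hxy))) h

/-- `M` is a quotient of the direct sum of its cyclic submodules. -/
lemma prop_of_forall_isSupported (M : ModuleCat.{u} S) (h : ∀ m : M, IsSupported P m) : P M := by
  have := IsLocalizing.closedUnderDirectSums (P := P) M
  let X (m : M) : ModuleCat.{u} S := ModuleCat.of S (Submodule.span S {m})
  let p : (∐ X) ⟶ M := Sigma.desc fun m ↦ ModuleCat.ofHom (Submodule.span S {m}).subtype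
  have : Epi p := (ModuleCat.epi_iff_surjective p).2 fun m ↦
    ⟨Sigma.ι X m ⟨m, Submodule.mem_span_singleton_self m⟩, by
      rw [← ModuleCat.comp_apply, Sigma.ι_desc]
      rfl⟩
  exact P.prop_of_epi p (P.prop_colimit _ fun m ↦ h m.as)

/-- Every submodule admits a maximal submodule disjoint from it. -/
lemma exists_maximal_disjoint {M : Type u} [AddCommGroup M] [Module S M] (T : Submodule S M) :
    ∃ C : Submodule S M, Maximal (Disjoint T) C := by
  obtain ⟨C, -, hC⟩ := zorn_le_nonempty₀ {C : Submodule S M | Disjoint T C}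
    (fun c hc hchain C hC ↦ ⟨sSup c,
      (DirectedOn.disjoint_sSup_right hchain.directedOn).2 hc, fun _ hz ↦ le_sSup hz⟩)
    ⊥ disjoint_bot_right
  exact ⟨C, hC⟩

/-- If `U` misses the image of `T`, its preimage is disjoint from `T` and contains `C`, hence equals
`C` by maximality. -/
lemma isEssentialSubmodule_map_mkQ {M : Type u} [AddCommGroup M] [Module S M]
    {T C : Submodule S M} (h : Maximal (Disjoint T) C) :
    IsEssentialSubmodule (T.map C.mkQ) := by
  intro U hU hbot
  apply hU
  have hle : C ≤ U.comap C.mkQ := fun x hx ↦ by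
    simp [(Submodule.Quotient.mk_eq_zero C).2 hx]
  have hd : Disjoint T (U.comap C.mkQ) := by
    rw [Submodule.disjoint_def]
    intro x hxT hxU
    have hx : C.mkQ x ∈ T.map C.mkQ ⊓ U := ⟨Submodule.mem_map_of_mem hxT, hxU⟩
    rw [hbot, Submodule.mem_bot, Submodule.mkQ_apply, Submodule.Quotient.mk_eq_zero] at hx
    exact (Submodule.disjoint_def.1 h.prop) x hxT hx
  have hc := h.le_of_ge hd hle
  rw [eq_bot_iff]
  intro y hy
  obtain ⟨x, rfl⟩ := C.mkQ_surjective y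
  simpa using hc hy

/-- For a stable localizing subcategory, the torsion submodule of an injective module is a direct
summand. -/
lemma exists_retraction (hP : IsStable P) {T E : ModuleCat.{u} S} [Injective E] (f : T ⟶ E)
    (hf : Function.Injective f) (hT : ∀ x : E, IsSupported P x ↔ ∃ y, f y = x) :
    ∃ r : E ⟶ T, f ≫ r = 𝟙 T := by
  have hPT : P T := prop_of_forall_isSupported T fun m ↦
    IsSupported.of_injective (f := f.hom) hf ((hT _).2 ⟨m, rfl⟩)
  obtain ⟨C, hC⟩ := exists_maximal_disjoint (LinearMap.range f.hom)
  -- `E ⧸ C` is an essential extension of the image of `T`, so stability makes it torsion.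
  have hEC : P (ModuleCat.of S (E ⧸ C)) := by
    refine hP _ _ (isEssentialSubmodule_map_mkQ hC) (prop_map _ ?_)
    have : Epi (ModuleCat.ofHom f.hom.rangeRestrict) :=
      (ModuleCat.epi_iff_surjective _).2 f.hom.surjective_rangeRestrict
    exact P.prop_of_epi (ModuleCat.ofHom f.hom.rangeRestrict) hPT
  let q : E ⟶ ModuleCat.of S (E ⧸ C) := ModuleCat.ofHom C.mkQ
  have hm : Mono (f ≫ q) := by
    rw [ModuleCat.mono_iff_injective, injective_iff_map_eq_zero (f ≫ q).hom]
    intro x hx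
    have hxC : f x ∈ C := (Submodule.Quotient.mk_eq_zero C).1 hx
    have := Submodule.disjoint_def.1 hC.prop (f x) ⟨x, rfl⟩ hxC
    exact hf (this.trans (map_zero f.hom).symm)
  -- Injectivity of `E` extends `f` along `T ↪ E ⧸ C`; since the source is torsion, the extension
  -- lands in `T`, which yields the retraction.
  let g : ModuleCat.of S (E ⧸ C) ⟶ E := Injective.factorThru f (f ≫ q)
  have hg : (f ≫ q) ≫ g = f := Injective.comp_factorThru _ _
  let e := LinearEquiv.ofInjective f.hom hf
  have hgr (x : ModuleCat.of S (E ⧸ C)) : g x ∈ LinearMap.range f.hom :=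
    (hT _).1 ((IsSupported.of_prop hEC x).map g.hom)
  let r₀ : ModuleCat.of S (E ⧸ C) ⟶ T :=
    ModuleCat.ofHom (e.symm.toLinearMap ∘ₗ g.hom.codRestrict _ hgr)
  have hr₀ : r₀ ≫ f = g := by
    ext x
    exact congr_arg Subtype.val (e.apply_symm_apply (g.hom.codRestrict _ hgr _))
  have := (ModuleCat.mono_iff_injective f).2 hf
  refine ⟨q ≫ r₀, ?_⟩
  rw [← cancel_mono f, Category.assoc, Category.assoc, hr₀, ← Category.assoc, hg, Category.id_comp]

/-- `E.X₁` is a retract of `E.X₂`, so the sequence splits. Lifting a map from a torsion object along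
the section gives torsion elements of `E.X₂`; these lie in `E.X₁` and die in `E.X₃`. -/
lemma isTorsionFree_and_injective_of_isStable (hP : IsStable P)
    {E : ShortComplex (ModuleCat.{u} S)} (hE : E.ShortExact) [Injective E.X₂]
    (hT : ∀ x : E.X₂, IsSupported P x ↔ ∃ y, E.f y = x) :
    IsTorsionFree P E.X₃ ∧ Injective E.X₃ := by
  have := hE.mono_f
  obtain ⟨r, hr⟩ := exists_retraction hP E.f ((ModuleCat.mono_iff_injective E.f).1 this) hT
  have : Injective E.X₁ := (Retract.mk E.f r hr).injective
  have s := hE.splittingOfInjective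
  refine ⟨fun W hW f ↦ ?_, (Retract.mk s.s E.g s.s_g).injective⟩
  ext w
  obtain ⟨y, hy⟩ := (hT _).1 ((IsSupported.of_prop hW w).map (f ≫ s.s).hom)
  have h₁ : E.g (E.f y) = 0 := by rw [← ModuleCat.comp_apply, E.zero]; rfl
  have h₂ : E.g ((f ≫ s.s) w) = f w := by
    rw [← ModuleCat.comp_apply, Category.assoc, s.s_g, Category.comp_id]
  exact h₂.symm.trans ((congr_arg E.g hy.symm).trans h₁)

lemma restrictScalars_exact {S R : Type u} [Ring S] [Ring R] (φ : S →+* R) :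
    PreservesFiniteLimits (ModuleCat.restrictScalars.{u} φ) ∧
      PreservesFiniteColimits (ModuleCat.restrictScalars.{u} φ) := by
  refine ((ModuleCat.restrictScalars.{u} φ).exact_tfae.out 0 3).1 fun E hE ↦ ?_
  have := hE.mono_f
  have := hE.epi_g
  exact
    { exact := (ShortComplex.ShortExact.moduleCat_exact_iff_function_exact _).2
        ((ShortComplex.ShortExact.moduleCat_exact_iff_function_exact E).1 hE.exact)
      mono_f := (ModuleCat.mono_iff_injective _).2 ((ModuleCat.mono_iff_injective E.f).1 ‹_›)
      epi_g := (ModuleCat.epi_iff_surjective _).2 ((ModuleCat.epi_iff_surjective E.g).1 ‹_›) }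

instance {S R : Type u} [Ring S] [Ring R] (φ : S →+* R) :
    PreservesFiniteLimits (ModuleCat.restrictScalars.{u} φ) := (restrictScalars_exact φ).1

instance {S R : Type u} [Ring S] [Ring R] (φ : S →+* R) :
    PreservesFiniteColimits (ModuleCat.restrictScalars.{u} φ) := (restrictScalars_exact φ).2

lemma isStableTorsion_of_isStable (hP : IsStable P) {R : Type u} [Ring R] (φ : S →+* R)
    (hφ : ∀ X : ModuleCat.{u} R, Injective X →
      Injective ((ModuleCat.restrictScalars.{u} φ).obj X))
    {Γ : ModuleCat.{u} R ⥤ ModuleCat.{u} R} (i : Γ ⟶ 𝟭 _)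
    (hi : ∀ X, Function.Injective (i.app X))
    (hΓ : ∀ (X : ModuleCat.{u} R) (x : X),
      IsSupported (M := (ModuleCat.restrictScalars.{u} φ).obj X) P x ↔ ∃ y, i.app X y = x) :
    IsStableTorsion i (ModuleCat.restrictScalars.{u} φ) P := by
  have mono (X) : Mono (i.app X) := (ModuleCat.mono_iff_injective _).2 (hi X)
  have hs (X) (y : Γ.obj X) :
      IsSupported (M := (ModuleCat.restrictScalars.{u} φ).obj (Γ.obj X)) P y :=
    IsSupported.of_injective (M := (ModuleCat.restrictScalars.{u} φ).obj (Γ.obj X))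
      (N := (ModuleCat.restrictScalars.{u} φ).obj X)
      (f := ((ModuleCat.restrictScalars.{u} φ).map (i.app X)).hom) (hi X)
      ((hΓ X (i.app X y)).2 ⟨y, rfl⟩)
  have key (X : ModuleCat.{u} R) [Injective X] :
      IsTorsionFree P ((ModuleCat.restrictScalars.{u} φ).obj (cokernel (i.app X))) ∧
        Injective ((ModuleCat.restrictScalars.{u} φ).obj (cokernel (i.app X))) := by
    let E := ShortComplex.mk (i.app X) (cokernel.π (i.app X)) (by simp)
    have hE : E.ShortExact :=
      { exact := ShortComplex.exact_cokernel _
        mono_f := mono X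
        epi_g := inferInstanceAs (Epi (cokernel.π _)) }
    have : Injective (E.map (ModuleCat.restrictScalars.{u} φ)).X₂ := hφ X inferInstance
    exact isTorsionFree_and_injective_of_isStable hP
      (hE.map_of_exact (ModuleCat.restrictScalars.{u} φ)) (hΓ X)
  refine ⟨mono, fun X ↦ ?_, fun X ↦ ?_, fun X _ ↦ (key X).1, fun X _ ↦ (key X).2⟩
  · have := mono (Γ.obj X)
    have : Epi (i.app (Γ.obj X)) :=
      (ModuleCat.epi_iff_surjective _).2 fun y ↦ (hΓ (Γ.obj X) y).1 (hs X y)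
    exact isIso_of_mono_of_epi _
  · exact prop_of_forall_isSupported _ (hs X)

end Modules

/-! ### Flatness and injectivity under restriction of scalars. -/

section Flat

variable {K : Type v} [CommRing K] {A C : Type u} [Ring A] [Ring C] [Algebra K A] [Algebra K C]

section Induced

variable (K A C)
variable (X : Type u) [AddCommGroup X] [Module K X] [Module C X] [IsScalarTower K C X]

/-- The `A ⊗[K] C`-module induced by a `C`-module `X`, on the abelian group `A ⊗[K] X`. -/
noncomputable abbrev inducedModule : Module (A ⊗[K] C) (A ⊗[K] X) :=
  Module.compHom (A ⊗[K] X) (((Module.endTensorEndAlgHom (R := K) (S := K) (A := K) (M := A)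
    (N := X)).comp (Algebra.TensorProduct.map (Algebra.lmul K A) (Algebra.lsmul K K X :
      C →ₐ[K] Module.End K X))).toRingHom)

variable {K A C X}

lemma inducedModule_tmul_smul (a a' : A) (c : C) (x : X) :
    letI := inducedModule K A C X
    (a ⊗ₜ[K] c) • (a' ⊗ₜ[K] x) = (a * a') ⊗ₜ[K] (c • x) := rfl

/-- An additive map out of an induced module is linear if it is so on pure tensors. -/
noncomputable def inducedLinearMap {N : Type u} [AddCommGroup N] [Module (A ⊗[K] C) N]
    (f : A ⊗[K] X →+ N)
    (hf : ∀ (a a' : A) (c : C) (x : X),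
      f ((a * a') ⊗ₜ[K] (c • x)) = (a ⊗ₜ[K] c) • f (a' ⊗ₜ[K] x)) :
    letI := inducedModule K A C X
    A ⊗[K] X →ₗ[A ⊗[K] C] N :=
  letI := inducedModule K A C X
  { f with
    map_smul' := fun r t ↦ by
      change f (r • t) = r • f t
      induction t using TensorProduct.induction_on with
      | zero => rw [smul_zero, map_zero, smul_zero]
      | add t t' ht ht' => rw [smul_add, map_add, ht, ht', map_add, smul_add]
      | tmul a' x =>
        induction r using TensorProduct.induction_on with
        | zero => rw [zero_smul, map_zero, zero_smul]
        | add r r' hr hr' => rw [add_smul, map_add, hr, hr', add_smul]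
        | tmul a c => exact hf a a' c x }

/-- The linear map out of an induced module determined by a `C`-linear map. -/
noncomputable def inducedLift {N : Type u} [AddCommGroup N] [Module (A ⊗[K] C) N] (f : X →+ N)
    (hf : ∀ (c : C) (x : X), f (c • x) = ((1 : A) ⊗ₜ[K] c) • f x) :
    letI := inducedModule K A C X
    A ⊗[K] X →ₗ[A ⊗[K] C] N :=
  inducedLinearMap (TensorProduct.liftAddHom
    (((smulAddHom (A ⊗[K] C) N).comp
      (Algebra.TensorProduct.includeLeft : A →ₐ[K] A ⊗[K] C).toRingHom.toAddMonoidHom).compl₂ f)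
    (fun k a x ↦ by
      change ((k • a) ⊗ₜ[K] (1 : C)) • f x = (a ⊗ₜ[K] (1 : C)) • f (k • x)
      rw [← algebraMap_smul C k x, hf, smul_smul, Algebra.TensorProduct.tmul_mul_tmul, mul_one,
        one_mul, Algebra.algebraMap_eq_smul_one, TensorProduct.tmul_smul, TensorProduct.smul_tmul']))
    (fun a a' c x ↦ by
      change ((a * a') ⊗ₜ[K] (1 : C)) • f (c • x) = (a ⊗ₜ[K] c) • (a' ⊗ₜ[K] (1 : C)) • f x
      rw [hf, smul_smul, smul_smul]
      simp)

lemma inducedLift_tmul {N : Type u} [AddCommGroup N] [Module (A ⊗[K] C) N] (f : X →+ N)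
    (hf : ∀ (c : C) (x : X), f (c • x) = ((1 : A) ⊗ₜ[K] c) • f x) (a : A) (x : X) :
    letI := inducedModule K A C X
    inducedLift f hf (a ⊗ₜ[K] x) = (a ⊗ₜ[K] (1 : C)) • f x := rfl

end Induced

/-- If `A` is flat, then injective `A ⊗[K] C`-modules are injective as `C`-modules. -/
lemma injective_restrictScalars_includeRight [Module.Flat K A] (I : ModuleCat.{u} (A ⊗[K] C))
    [Injective I] :
    Injective ((ModuleCat.restrictScalars.{u}
      (Algebra.TensorProduct.includeRight : C →ₐ[K] A ⊗[K] C).toRingHom).obj I) where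
  -- Induction `A ⊗[K] -` preserves the injection `f` by flatness. The map `G` induced by `g`
  -- therefore extends to `A ⊗[K] Y`, and restricting along `y ↦ 1 ⊗ y` extends `g`.
  factors {X Y} g f _ := by
    let : Module K X := Module.compHom X (algebraMap K C)
    let : Module K Y := Module.compHom Y (algebraMap K C)
    have : IsScalarTower K C X := ⟨fun k c x ↦ by
      rw [Algebra.smul_def, mul_smul]; rfl⟩
    have : IsScalarTower K C Y := ⟨fun k c x ↦ by
      rw [Algebra.smul_def, mul_smul]; rfl⟩
    let := inducedModule K A C X
    let := inducedModule K A C Y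
    let fK : X →ₗ[K] Y := f.hom.restrictScalars K
    have hfK : Function.Injective fK := (ModuleCat.mono_iff_injective f).1 ‹_›
    let F : A ⊗[K] X →ₗ[A ⊗[K] C] A ⊗[K] Y :=
      inducedLinearMap (fK.lTensor A).toAddMonoidHom (fun a a' c x ↦ by
        change (a * a') ⊗ₜ[K] f.hom (c • x) = (a ⊗ₜ[K] c) • (a' ⊗ₜ[K] f.hom x)
        rw [map_smul, inducedModule_tmul_smul])
    have hF : Mono (ModuleCat.ofHom F) := (ModuleCat.mono_iff_injective _).2
      (Module.Flat.lTensor_preserves_injective_linearMap fK hfK)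
    let g₀ : X →+ I :=
      { toFun := g.hom
        map_zero' := map_zero g.hom
        map_add' := map_add g.hom }
    let G : A ⊗[K] X →ₗ[A ⊗[K] C] I :=
      inducedLift g₀ fun c x ↦ g.hom.map_smul c x
    let H := Injective.factorThru (J := I) (ModuleCat.ofHom G) (ModuleCat.ofHom F)
    have hH (t : A ⊗[K] X) : H (F t) = G t :=
      ConcreteCategory.congr_hom
        (Injective.comp_factorThru (J := I) (ModuleCat.ofHom G) (ModuleCat.ofHom F)) t
    let h : Y →ₗ[C] (ModuleCat.restrictScalars.{u}
        (Algebra.TensorProduct.includeRight : C →ₐ[K] A ⊗[K] C).toRingHom).obj I :=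
      { toFun := fun y ↦ H ((1 : A) ⊗ₜ[K] y)
        map_add' := fun y y' ↦ by
          rw [TensorProduct.tmul_add]
          exact map_add H.hom _ _
        map_smul' := fun c y ↦ by
          have e : ((1 : A) ⊗ₜ[K] (c • y) : A ⊗[K] Y) =
              ((1 : A) ⊗ₜ[K] c) • ((1 : A) ⊗ₜ[K] y) := by
            rw [inducedModule_tmul_smul, one_mul]
          rw [e]
          exact map_smul H.hom _ _ }
    refine ⟨ConcreteCategory.ofHom (C := ModuleCat.{u} C) h, ?_⟩
    ext x
    refine (hH ((1 : A) ⊗ₜ[K] x)).trans ?_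
    refine (inducedLift_tmul (N := I) g₀ _ 1 x).trans ?_
    exact one_smul (A ⊗[K] C) (g x : I)

/-- If `C` is flat, then injective `A ⊗[K] C`-modules are injective as `A`-modules. -/
lemma injective_restrictScalars_includeLeft [Module.Flat K C] (I : ModuleCat.{u} (A ⊗[K] C))
    [Injective I] :
    Injective ((ModuleCat.restrictScalars.{u}
      (Algebra.TensorProduct.includeLeft : A →ₐ[K] A ⊗[K] C).toRingHom).obj I) := by
  -- Swapping the tensor factors is an equivalence of module categories, which reduces the claim to
  -- the right-hand case.
  let e := (Algebra.TensorProduct.comm K C A).toRingEquiv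
  have hI : Injective ((ModuleCat.restrictScalars.{u} e.toRingHom).obj I) :=
    ((ModuleCat.restrictScalarsEquivalenceOfRingEquiv.{u} e).map_injective_iff I).2 inferInstance
  have := injective_restrictScalars_includeRight (K := K) (A := C) (C := A)
    ((ModuleCat.restrictScalars.{u} e.toRingHom).obj I)
  refine Injective.of_iso (((ModuleCat.restrictScalarsComp'.{u}
    (Algebra.TensorProduct.includeRight : A →ₐ[K] C ⊗[K] A).toRingHom e.toRingHom
    (Algebra.TensorProduct.includeLeft : A →ₐ[K] A ⊗[K] C).toRingHom ?_).app I).symm) this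
  ext a
  exact rfl

end Flat

/-! ### The two torsion functors on bimodules. -/

section Comparison

variable {K : Type v} [CommRing K] {A B : Type u} [Ring A] [Ring B] [Algebra K A] [Algebra K B]

variable (K B) in
/-- The inclusion of the torsion functor `Γ_P` into the identity. -/
noncomputable def leftΓι (P : ObjectProperty (ModuleCat.{u} A)) [IsLocalizing P] :
    leftΓ K B P ⟶ 𝟭 (Bimod K A B) where
  app X := ModuleCat.ofHom (leftTorsion P X).subtype

variable (K A) in
/-- The inclusion of the torsion functor `Γ_Q` into the identity. -/
noncomputable def rightΓι (Q : ObjectProperty (ModuleCat.{u} Bᵐᵒᵖ)) [IsLocalizing Q] :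
    rightΓ K A Q ⟶ 𝟭 (Bimod K A B) where
  app X := ModuleCat.ofHom (rightTorsion Q X).subtype

lemma isStableTorsion_leftΓι [Module.Flat K B] {P : ObjectProperty (ModuleCat.{u} A)}
    [IsLocalizing P] (hP : IsStable P) :
    IsStableTorsion (leftΓι K B P) (forgetToLeft K A B) P :=
  have : Module.Flat K Bᵐᵒᵖ := .of_linearEquiv (MulOpposite.opLinearEquiv K).symm
  isStableTorsion_of_isStable hP _ (fun I _ ↦ injective_restrictScalars_includeLeft I)
    (leftΓι K B P) (fun _ ↦ Subtype.val_injective)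
    fun _ x ↦ ⟨fun hx ↦ ⟨⟨x, hx⟩, rfl⟩, fun ⟨y, hy⟩ ↦ hy ▸ y.2⟩

lemma isStableTorsion_rightΓι [Module.Flat K A] {Q : ObjectProperty (ModuleCat.{u} Bᵐᵒᵖ)}
    [IsLocalizing Q] (hQ : IsStable Q) :
    IsStableTorsion (rightΓι K A Q) (forgetToRight K A B) Q :=
  isStableTorsion_of_isStable hQ _ (fun I _ ↦ injective_restrictScalars_includeRight I)
    (rightΓι K A Q) (fun _ ↦ Subtype.val_injective)
    fun _ x ↦ ⟨fun hx ↦ ⟨⟨x, hx⟩, rfl⟩, fun ⟨y, hy⟩ ↦ hy ▸ y.2⟩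

lemma crossSupported_le [HasDerivedCategory.{w} (Bimod K A B)]
    (P : ObjectProperty (ModuleCat.{u} A)) [IsLocalizing P]
    (Q : ObjectProperty (ModuleCat.{u} Bᵐᵒᵖ)) [IsLocalizing Q] :
    crossSupported K P Q ≤ crossProperty (homologyIn (forgetToLeft K A B) P)
      (homologyIn (forgetToRight K A B) Q) (leftRΓ K B P) (rightRΓ K A Q) :=
  fun _ hX ↦ ⟨fun q ↦ (hX q).1, fun q ↦ (hX q).2⟩

end Comparison

end BimoduleSupport

open BimoduleSupport in
/-- The isomorphism is natural on the full subcategory of all `X` satisfying the condition on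
cohomology with supports, and lives in the (unbounded) derived category of bimodules. -/
theorem theorem1p1 {K : Type v} [CommRing K] {A B : Type u} [Ring A] [Ring B]
    [Algebra K A] [Algebra K B] [Module.Flat K A] [Module.Flat K B]
    [HasDerivedCategory.{w} (Bimod K A B)]
    (P : ObjectProperty (ModuleCat.{u} A)) [IsLocalizing P]
    (Q : ObjectProperty (ModuleCat.{u} Bᵐᵒᵖ)) [IsLocalizing Q]
    (hP : IsStable P) (hP' : IsLocallyFinitelyResolved P)
    (hQ : IsStable Q) (hQ' : IsLocallyFinitelyResolved Q) :
    Nonempty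
      ((crossSupported K P Q).ι ⋙ leftRΓ K B P ⋙ DerivedCategory.Plus.ι ≅
        (crossSupported K P Q).ι ⋙ rightRΓ K A Q ⋙ DerivedCategory.Plus.ι) := by
  -- Being coreflections, the two functors agree without the finiteness assumptions `hP'`, `hQ'`.
  have e := coreflectionIso (isStableTorsion_leftΓι (K := K) (B := B) hP).isCoreflection
    (isStableTorsion_rightΓι (K := K) (A := A) hQ).isCoreflection
  exact ⟨Functor.isoWhiskerRight (Functor.isoWhiskerLeft
    (ObjectProperty.ιOfLE (crossSupported_le P Q)) e) DerivedCategory.Plus.ι⟩
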